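/- All graphs are finite, undirected and simple. A vertex of a tree $T$ is a leaf if its degree in $T$ is at most $1$, and internal otherwise. For positive integers $h,s,t$, an $(h,s,t)$-representation of a graph $G$ is a pair $(T,(S_u)_{u\in V(G)})$, where $T$ is a tree of maximum degree at most $h$ and each $S_u$ is a subtree of $T$ of maximum degree at most $s$, such that two distinct vertices $u$ and $v$ of $G$ are adjacent if and only if $S_u$ and $S_v$ have at least $t$ vertices in common. It is orthodox if, for every vertex $u$ of $G$, all leaves of $S_u$ are also leaves of $T$, and, for every two distinct vertices $u$ and $v$ of $G$, the following are equivalent: (i) $u$ and $v$ are adjacent; (ii) $S_u$ and $S_v$ have at least $t$ vertices in common; (iii) $S_u$ and $S_v$ share a leaf of $T$. Let ${\rm ORTH}[h,s,t]$ be the class of graphs that have an orthodox $(h,s,t)$-representation. A graph is twin-free if no two distinct vertices $u,v$ have the same closed neighbourhood $N[u]=N[v]$. The line graph $L(H)$ of $H$ has vertex set $E(H)$, two distinct edges of $H$ being adjacent in $L(H)$ if and only if they share a vertex. **Theorem.** Let $G$ be a connected twin-free line graph of order at least $4$, and let $H$ be a connected graph with $L(H)=G$ (up to isomorphism). Let $h\geq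 3$ and $t\geq 1$ be integers. Then $G$ is in ${\rm ORTH}[h,2,t]$ if and only if there is a tree $T$ whose internal vertices all have degree at most $h$ such that $V(H)$ is the set of leaves of $T$, and, for every two independent (that is, vertex-disjoint) edges $xy$ and $x'y'$ of $H$, the path in $T$ between $x$ and $y$ and the path in $T$ between $x'$ and $y'$ share at most $t-1$ vertices. (Such a $T$ is called an $(h,t)$-tree layout of $H$.) -/

import Mathlib

/-- Two distinct vertices `u`, `v` of `G` are twins if `N[u] = N[v]` (closed neighbourhoods);
`G` is twin-free if it has no twins. -/
def TwinFree {U : Type*} (G : SimpleGraph U) : Prop :=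
  ∀ u v : U, u ≠ v → insert u (G.neighborSet u) ≠ insert v (G.neighborSet v)

/-- A leaf of a (finite) tree `T` is a vertex of degree at most `1`. -/
def IsLeaf {W : Type*} (T : SimpleGraph W) (w : W) : Prop :=
  (T.neighborSet w).ncard ≤ 1

/-- A leaf of a (finite) subtree `S` of `T` is a vertex of `S` whose degree in `S` is at
most `1`. -/
def IsSubtreeLeaf {W : Type*} {T : SimpleGraph W} (S : T.Subgraph) (w : W) : Prop :=
  w ∈ S.verts ∧ (S.neighborSet w).ncard ≤ 1

/-- `(T, S)` is an `(h,s,t)`-representation of `G`: `T` is a tree of maximum degree at most `h`,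
every `S u` is a subtree of `T` of maximum degree at most `s`, and distinct vertices `u`, `v` of
`G` are adjacent if and only if `S u` and `S v` have at least `t` vertices in common. -/
structure IsRepresentation {U W : Type*} (h s t : ℕ) (G : SimpleGraph U) (T : SimpleGraph W)
    (S : U → T.Subgraph) : Prop where
  isTree : T.IsTree
  degree_le : ∀ w : W, (T.neighborSet w).ncard ≤ h
  subtree : ∀ u : U, (S u).coe.IsTree
  subtree_degree_le : ∀ u : U, ∀ w ∈ (S u).verts, ((S u).neighborSet w).ncard ≤ s
  adj_iff : ∀ u v : U, u ≠ v → (G.Adj u v ↔ t ≤ ((S u).verts ∩ (S v).verts).ncard)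

/-- An `(h,s,t)`-representation is orthodox if all leaves of every `S u` are leaves of `T`, and
distinct vertices `u`, `v` of `G` are adjacent if and only if `S u` and `S v` share a leaf
of `T`. (By `adj_iff`, this is also equivalent to having `t` vertices in common.) -/
structure IsOrthodoxRepresentation {U W : Type*} (h s t : ℕ) (G : SimpleGraph U)
    (T : SimpleGraph W) (S : U → T.Subgraph) : Prop
    extends IsRepresentation h s t G T S where
  leaf_of_leaf : ∀ u : U, ∀ w : W, IsSubtreeLeaf (S u) w → IsLeaf T w
  adj_iff_leaf : ∀ u v : U, u ≠ v →
    (G.Adj u v ↔ ∃ w : W, IsLeaf T w ∧ w ∈ (S u).verts ∧ w ∈ (S v).verts)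

/-- The class `ORTH[h,s,t]` of the graphs with an orthodox `(h,s,t)`-representation in a
finite host tree. -/
def InORTH {U : Type*} (h s t : ℕ) (G : SimpleGraph U) : Prop :=
  ∃ (W : Type) (_ : Finite W) (T : SimpleGraph W) (S : U → T.Subgraph),
    IsOrthodoxRepresentation h s t G T S

/-- `T` is an `(h,t)`-tree layout of `H`, where `φ` identifies the vertices of `H` with the
leaves of `T`: the internal vertices (those that are not leaves) of the tree `T` have degree at
most `h`, and for every two independent (that is, disjoint) edges `xy` and `x'y'` of `H` the paths
in `T` between `x` and `y` and between `x'` and `y'` share at most `t - 1` vertices. -/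
structure IsTreeLayout {V W : Type*} (h t : ℕ) (H : SimpleGraph V) (T : SimpleGraph W)
    (φ : V → W) : Prop where
  isTree : T.IsTree
  internal_degree_le : ∀ w : W, ¬ IsLeaf T w → (T.neighborSet w).ncard ≤ h
  injective : Function.Injective φ
  range_eq : Set.range φ = {w : W | IsLeaf T w}
  inter_le : ∀ x y x' y' : V, H.Adj x y → H.Adj x' y' →
    x ≠ x' → x ≠ y' → y ≠ x' → y ≠ y' →
    ∀ (p : T.Walk (φ x) (φ y)) (q : T.Walk (φ x') (φ y')), p.IsPath → q.IsPath →
      {w : W | w ∈ p.support ∧ w ∈ q.support}.ncard ≤ t - 1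

/-! With `s = 2`, each `S u` of an orthodox representation is a path whose ends are leaves of `T`,
and it contains no other leaf of `T`. So `S u` acts as an edge joining two leaves, and adjacency in
`G` means that two such edges share an end: the leaf pairs form another root of the line graph `G`,
apart from one-vertex paths. These are repaired by attaching two new leaves to every leaf of `T`.

A weak form of Whitney's theorem, `IsLineGraphMap.exists_injective`, compares the two roots. The
pairs assigned to the edges at a vertex of `H` meet pairwise, so they share an element unless three
of them form a triangle. If they always share one, the common elements define an injection of `V(H)`
into the leaves, where twin-freeness keeps different vertices apart. If a claw becomes a triangle,
`H` has only the four vertices of that claw, and an injection is written down directly. The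
injection need not induce the given map of edges. It is enough that every edge of `H` goes to the
pair of some vertex of `G`: independent edges then go to disjoint pairs, hence to nonadjacent
vertices of `G`, whose paths share fewer than `t` vertices. Pruning superfluous leaves gives the
layout.

Conversely, each edge of `H` is represented by its path in the layout. Lengthening all pendant
branches first makes paths with a common end share at least `t` vertices and adds nothing to the
intersections for independent edges. -/

open SimpleGraph

/-! ### Whitney's theorem: claws with a common element -/

/-- `m` maps the edges of the twin-free line graph of `H` to pairs of distinct elements of `X`,
such that two edges share an end if and only if their images share an element. -/
structure IsLineGraphMap {V X : Type*} (H : SimpleGraph V) (m : Sym2 V → Sym2 X) : Prop where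
  not_isDiag : ∀ e ∈ H.edgeSet, ¬ (m e).IsDiag
  meet_iff : ∀ e ∈ H.edgeSet, ∀ f ∈ H.edgeSet,
    (∃ p, p ∈ m e ∧ p ∈ m f) ↔ ∃ x, x ∈ e ∧ x ∈ f
  eq_of_meet : ∀ e ∈ H.edgeSet, ∀ f ∈ H.edgeSet,
    (∀ g ∈ H.edgeSet, (∃ x, x ∈ e ∧ x ∈ g) ↔ ∃ x, x ∈ f ∧ x ∈ g) → e = f

theorem SimpleGraph.Connected.mem_of_closed {V : Type*} {H : SimpleGraph V} (hH : H.Connected)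
    {S : Set V} {v : V} (hv : v ∈ S) (hS : ∀ x ∈ S, ∀ y, H.Adj x y → y ∈ S) (w : V) : w ∈ S := by
  obtain ⟨p⟩ := hH.preconnected v w
  induction p with
  | nil => exact hv
  | cons h _ ih => exact ih (hS _ hv _ h)

theorem Sym2.exists_mem_and_mem_iff {α : Type*} {a b c d : α} :
    (∃ x, x ∈ s(a, b) ∧ x ∈ s(c, d)) ↔ (a = c ∨ a = d) ∨ b = c ∨ b = d := by
  simp only [Sym2.mem_iff, or_and_right, exists_or, exists_eq_left]

namespace IsLineGraphMap

variable {V X : Type*} {H : SimpleGraph V} {m : Sym2 V → Sym2 X}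

theorem injOn (hm : IsLineGraphMap H m) : Set.InjOn m H.edgeSet := by
  intro e he f hf hef
  refine hm.eq_of_meet e he f hf fun g hg ↦ ?_
  rw [← hm.meet_iff e he g hg, ← hm.meet_iff f hf g hg, hef]

theorem eq_of_mem (hm : IsLineGraphMap H m) {e f : Sym2 V} (he : e ∈ H.edgeSet)
    (hf : f ∈ H.edgeSet) {p q : X} (hpq : p ≠ q) (hpe : p ∈ m e) (hqe : q ∈ m e) (hpf : p ∈ m f)
    (hqf : q ∈ m f) : e = f := by
  refine hm.injOn he hf ?_
  rw [(Sym2.mem_and_mem_iff hpq).1 ⟨hpe, hqe⟩, (Sym2.mem_and_mem_iff hpq).1 ⟨hpf, hqf⟩]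

/-- Unless a claw of `H` is mapped to a triangle, all edges at a vertex of degree at least two
are mapped to pairs with a common element. -/
theorem exists_forall_mem (hm : IsLineGraphMap H m)
    (hclaw : ∀ v a b c, H.Adj v a → H.Adj v b → H.Adj v c → a ≠ b → a ≠ c → b ≠ c →
      ∃ p, p ∈ m s(v, a) ∧ p ∈ m s(v, b) ∧ p ∈ m s(v, c))
    {v a b : V} (ha : H.Adj v a) (hb : H.Adj v b) (hab : a ≠ b) :
    ∃ p, ∀ c, H.Adj v c → p ∈ m s(v, c) := by
  obtain ⟨p, hpa, hpb⟩ := (hm.meet_iff s(v, a) ha s(v, b) hb).2 ⟨v, by simp⟩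
  refine ⟨p, fun c hc ↦ ?_⟩
  by_cases hac : a = c
  · rwa [← hac]
  by_cases hbc : b = c
  · rwa [← hbc]
  obtain ⟨q, hqa, hqb, hqc⟩ := hclaw v a b c ha hb hc hab hac hbc
  by_cases hpq : p = q
  · rwa [hpq]
  have := hm.eq_of_mem (e := s(v, a)) (f := s(v, b)) ha hb hpq hpa hqa hpb hqb
  exact absurd (Sym2.congr_right.1 this) hab

/-- If `v` and `w` differ, every edge at `v` meets every edge at `w`. This forces `v` and `w` to be
adjacent with exactly one further neighbour each, the same vertex `a`, and then `va` and `wa` are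
twins in the line graph. -/
theorem ne_of_forall_mem (hm : IsLineGraphMap H m) {v w a b c d : V} (hva : H.Adj v a)
    (hvb : H.Adj v b) (hab : a ≠ b) (hwc : H.Adj w c) (hwd : H.Adj w d) (hcd : c ≠ d) {p : X}
    (hv : ∀ x, H.Adj v x → p ∈ m s(v, x)) (hw : ∀ x, H.Adj w x → p ∈ m s(w, x)) : v = w := by
  by_contra hvw
  have key : ∀ x y, H.Adj v x → H.Adj w y → v = y ∨ x = w ∨ x = y := by
    intro x y hx hy
    obtain ⟨z, hz, hz'⟩ := (hm.meet_iff s(v, x) hx s(w, y) hy).1 ⟨p, hv x hx, hw y hy⟩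
    simp only [Sym2.mem_iff] at hz hz'
    grind
  -- Without the edge `vw`, `key` would make each neighbour of `v` equal to each neighbour of `w`,
  -- but `v` has two neighbours.
  have hadj : H.Adj v w := by
    by_contra hn
    have h1 : ∀ x, H.Adj v x → x ≠ w := fun x hx h ↦ hn (h ▸ hx)
    have h2 : ∀ x, H.Adj w x → v ≠ x := fun x hx h ↦ hn (h ▸ hx.symm)
    grind
  obtain ⟨a, hva, haw⟩ : ∃ a, H.Adj v a ∧ a ≠ w := by grind
  obtain ⟨c, hwc, hcv⟩ : ∃ c, H.Adj w c ∧ v ≠ c := by grind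
  have hac : a = c := by grind
  subst hac
  have hv' : ∀ x, H.Adj v x → x = w ∨ x = a := fun x hx ↦ by grind
  have hw' : ∀ x, H.Adj w x → x = v ∨ x = a := fun x hx ↦ by grind
  have : s(v, a) = s(w, a) := by
    refine hm.eq_of_meet _ hva _ hwc fun g hg ↦ ?_
    induction g with
    | h x y =>
      have hg : H.Adj x y := hg
      have := hg.symm
      rw [Sym2.exists_mem_and_mem_iff, Sym2.exists_mem_and_mem_iff]
      clear hm hv hw key
      grind
  exact hvw (Sym2.congr_left.1 this)

theorem exists_injective_of_claw (hm : IsLineGraphMap H m) (hH : H.Connected)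
    (hE : ∀ e₁ e₂ e₃ : Sym2 V, ∃ e ∈ H.edgeSet, e ≠ e₁ ∧ e ≠ e₂ ∧ e ≠ e₃)
    (hclaw : ∀ v a b c, H.Adj v a → H.Adj v b → H.Adj v c → a ≠ b → a ≠ c → b ≠ c →
      ∃ p, p ∈ m s(v, a) ∧ p ∈ m s(v, b) ∧ p ∈ m s(v, c)) :
    ∃ ψ : V → X, Function.Injective ψ ∧
      ∀ x y, H.Adj x y → s(ψ x, ψ y) ∈ m '' H.edgeSet := by
  let D : V → Prop := fun v ↦ ∃ a b, a ≠ b ∧ H.Adj v a ∧ H.Adj v b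
  have hN : ∀ v, ∃ w, H.Adj v w := by
    intro v
    by_contra! hv
    have h1 := hH.mem_of_closed (S := {v}) rfl (by rintro x rfl y hxy; exact (hv y hxy).elim)
    obtain ⟨e, he, -⟩ := hE s(v, v) s(v, v) s(v, v)
    induction e with
    | h x y => exact H.ne_of_adj he ((h1 x).trans (h1 y).symm)
  -- Two adjacent vertices of degree one would form a component with a single edge.
  have hD : ∀ v w, H.Adj v w → D v ∨ D w := by
    intro v w hvw
    by_contra! hn
    have h1 := hH.mem_of_closed (S := {v, w}) (v := v) (by simp) (by
      rintro x (rfl | rfl) y hxy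
      · exact Or.inr (by_contra fun h ↦ hn.1 ⟨y, w, h, hxy, hvw⟩)
      · exact Or.inl (by_contra fun h ↦ hn.2 ⟨y, v, h, hxy, hvw.symm⟩))
    obtain ⟨e, he, hne, -⟩ := hE s(v, w) s(v, v) s(v, v)
    induction e with
    | h x y =>
      have hxy := H.ne_of_adj he
      have hx : x = v ∨ x = w := h1 x
      have hy : y = v ∨ y = w := h1 y
      simp only [ne_eq, Sym2.eq_iff] at hne
      grind
  have hc : ∀ v, ∃ p, D v → ∀ c, H.Adj v c → p ∈ m s(v, c) := by
    intro v
    by_cases hv : D v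
    · obtain ⟨a, b, hab, ha, hb⟩ := hv
      obtain ⟨p, hp⟩ := hm.exists_forall_mem hclaw ha hb hab
      exact ⟨p, fun _ ↦ hp⟩
    · obtain ⟨w, hw⟩ := hN v
      obtain ⟨p, -⟩ := (hm.meet_iff s(v, w) hw s(v, w) hw).2 ⟨v, by simp⟩
      exact ⟨p, fun h ↦ (hv h).elim⟩
  choose c hc using hc
  have hcD : ∀ v w, D v → D w → c v = c w → v = w := by
    rintro v w hv hw hvw
    have h1 := hc v hv
    have h2 := hc w hw
    rw [← hvw] at h2
    obtain ⟨a, b, hab, ha, hb⟩ := hv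
    obtain ⟨a', b', hab', ha', hb'⟩ := hw
    exact hm.ne_of_forall_mem ha hb hab ha' hb' hab' h1 h2
  -- A vertex of degree at least two goes to its common element `c v`. A pendant vertex goes to the
  -- element of its only edge's pair that is not accounted for by its neighbour.
  have hψ : ∀ v, ∃ p, (D v → p = c v) ∧ (¬ D v → ∀ w, H.Adj v w → m s(v, w) = s(c w, p)) := by
    intro v
    by_cases hv : D v
    · exact ⟨c v, fun _ ↦ rfl, fun h ↦ (h hv).elim⟩
    · obtain ⟨w, hw⟩ := hN v
      have hwD := (hD v w hw).resolve_left hv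
      have h1 := hc w hwD v hw.symm
      rw [Sym2.eq_swap] at h1
      obtain ⟨p, hp⟩ := h1
      refine ⟨p, fun h ↦ (hv h).elim, fun _ w' hw' ↦ ?_⟩
      obtain rfl : w' = w := by_contra fun h ↦ hv ⟨w', w, h, hw', hw⟩
      exact hp
  choose ψ hψ hψ' using hψ
  have hmem : ∀ v w, H.Adj v w → ψ v ∈ m s(v, w) := by
    intro v w hvw
    by_cases hv : D v
    · rw [hψ v hv]; exact hc v hv w hvw
    · rw [hψ' v hv w hvw]; simp
  have hne : ∀ v w, H.Adj v w → ψ v ≠ ψ w := by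
    have aux : ∀ v w, H.Adj v w → ¬ D v → ψ v ≠ ψ w := by
      intro v w hvw hv h
      have hw := (hD v w hvw).resolve_left hv
      have h1 := hψ' v hv w hvw
      have h2 := hm.not_isDiag s(v, w) hvw
      rw [h1, h, hψ w hw] at h2
      simp at h2
    intro v w hvw
    by_cases hv : D v
    · by_cases hw : D w
      · rw [hψ v hv, hψ w hw]
        exact fun h ↦ hvw.ne (hcD v w hv hw h)
      · exact (aux w v hvw.symm hw).symm
    · exact aux v w hvw hv
  refine ⟨ψ, ?_, fun x y hxy ↦ ⟨s(x, y), hxy, ?_⟩⟩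
  · have aux : ∀ v v', ¬ D v → ψ v = ψ v' → v = v' := by
      intro v v' hv h
      by_contra hvv
      obtain ⟨w, hw⟩ := hN v
      have hw1 : ∀ x, H.Adj v x → x = w :=
        fun x hx ↦ by_contra fun h ↦ hv ⟨x, w, h, hx, hw⟩
      have hnadj : ∀ x, H.Adj v' x → v' = w ∨ x = w ∨ x = v := by
        intro x hx
        obtain ⟨z, hz, hz'⟩ := (hm.meet_iff s(v, w) hw s(v', x) hx).1
          ⟨ψ v, hmem v w hw, h ▸ hmem v' x hx⟩
        simp only [Sym2.mem_iff] at hz hz'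
        grind
      have hv'w : v' ≠ w := by
        rintro rfl
        exact hne v v' hw h
      by_cases hv' : D v'
      · obtain ⟨a, b, hab, ha, hb⟩ := hv'
        have := hnadj a ha
        have := hnadj b hb
        grind [SimpleGraph.Adj.symm]
      · obtain ⟨x, hx⟩ := hN v'
        have hxw : x = w := by
          have := hnadj x hx
          grind [SimpleGraph.Adj.symm]
        subst hxw
        have h1 := hψ' v hv x hw
        have h2 := hψ' v' hv' x hx
        rw [h, ← h2] at h1
        exact hvv (Sym2.congr_left.1 (hm.injOn hw hx h1))
    intro v v' h
    by_cases hv : D v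
    · by_cases hv' : D v'
      · exact hcD v v' hv hv' (by rw [← hψ v hv, ← hψ v' hv', h])
      · exact (aux v' v hv' h.symm).symm
    · exact aux v v' hv h
  · refine (Sym2.mem_and_mem_iff (hne x y hxy)).1 ⟨hmem x y hxy, ?_⟩
    rw [Sym2.eq_swap]
    exact hmem y x hxy.symm

end IsLineGraphMap

/-! ### Whitney's theorem: claws mapped to triangles -/

namespace IsLineGraphMap

variable {V X : Type*} {H : SimpleGraph V} {m : Sym2 V → Sym2 X}

theorem meet_mk_iff (hm : IsLineGraphMap H m) {a b c d : V} (hab : H.Adj a b) (hcd : H.Adj c d) :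
    (∃ p, p ∈ m s(a, b) ∧ p ∈ m s(c, d)) ↔ (a = c ∨ a = d) ∨ b = c ∨ b = d :=
  (hm.meet_iff s(a, b) hab s(c, d) hcd).trans Sym2.exists_mem_and_mem_iff

theorem exists_triangle (hm : IsLineGraphMap H m) {v a b c : V} (ha : H.Adj v a) (hb : H.Adj v b)
    (hc : H.Adj v c) (hn : ¬ ∃ p, p ∈ m s(v, a) ∧ p ∈ m s(v, b) ∧ p ∈ m s(v, c)) :
    ∃ x y z, x ≠ y ∧ x ≠ z ∧ y ≠ z ∧ m s(v, a) = s(y, z) ∧ m s(v, b) = s(x, z) ∧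
      m s(v, c) = s(x, y) := by
  obtain ⟨z, hza, hzb⟩ := (hm.meet_mk_iff ha hb).2 (by simp)
  obtain ⟨y, hya, hyc⟩ := (hm.meet_mk_iff ha hc).2 (by simp)
  obtain ⟨x, hxb, hxc⟩ := (hm.meet_mk_iff hb hc).2 (by simp)
  have hxy : x ≠ y := by rintro rfl; exact hn ⟨x, hya, hxb, hxc⟩
  have hxz : x ≠ z := by rintro rfl; exact hn ⟨x, hza, hxb, hxc⟩
  have hyz : y ≠ z := by rintro rfl; exact hn ⟨y, hya, hzb, hyc⟩
  exact ⟨x, y, z, hxy, hxz, hyz, (Sym2.mem_and_mem_iff hyz).1 ⟨hya, hza⟩,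
    (Sym2.mem_and_mem_iff hxz).1 ⟨hxb, hzb⟩, (Sym2.mem_and_mem_iff hxy).1 ⟨hxc, hyc⟩⟩

/-- If a claw at `v` is mapped to a triangle, then all edges at an end of the claw lie within the
claw. -/
theorem eq_of_adj_of_triangle (hm : IsLineGraphMap H m) {v a b c d : V} {x y z : X}
    (hav : H.Adj v a) (hb : H.Adj v b) (hc : H.Adj v c) (hab : a ≠ b) (hac : a ≠ c)
    (ha' : m s(v, a) = s(y, z)) (hb' : m s(v, b) = s(x, z)) (hc' : m s(v, c) = s(x, y))
    (hd : H.Adj a d) : d = v ∨ d = b ∨ d = c := by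
  obtain ⟨p, hpd, hp⟩ := (hm.meet_mk_iff hd hav).2 (by simp)
  rw [ha', Sym2.mem_iff] at hp
  rcases hp with rfl | rfl
  · have := (hm.meet_mk_iff hd hc).1 ⟨p, hpd, by rw [hc']; simp⟩
    have := hav.ne
    grind
  · have := (hm.meet_mk_iff hd hb).1 ⟨p, hpd, by rw [hb']; simp⟩
    have := hav.ne
    grind

/-- A pair that meets all three sides of the triangle contains two of its corners, so it is one of
the sides. Hence a fourth edge at `v` would have the same image as an edge of the claw. -/
theorem eq_of_adj_center_of_triangle (hm : IsLineGraphMap H m) {v a b c d : V} {x y z : X}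
    (ha : H.Adj v a) (hb : H.Adj v b) (hc : H.Adj v c)
    (hxy : x ≠ y) (hxz : x ≠ z) (hyz : y ≠ z)
    (ha' : m s(v, a) = s(y, z)) (hb' : m s(v, b) = s(x, z)) (hc' : m s(v, c) = s(x, y))
    (hd : H.Adj v d) : d = a ∨ d = b ∨ d = c := by
  obtain ⟨p, hpd, hp⟩ := (hm.meet_mk_iff hd ha).2 (by simp)
  obtain ⟨q, hqd, hq⟩ := (hm.meet_mk_iff hd hb).2 (by simp)
  obtain ⟨r, hrd, hr⟩ := (hm.meet_mk_iff hd hc).2 (by simp)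
  have hA {p q} (hpq : p ≠ q) (hp : p ∈ m s(v, d)) (hq : q ∈ m s(v, d))
      (hp' : p ∈ m s(v, a)) (hq' : q ∈ m s(v, a)) : d = a :=
    Sym2.congr_right.1 (hm.eq_of_mem (e := s(v, d)) (f := s(v, a)) hd ha hpq hp hq hp' hq')
  have hB {p q} (hpq : p ≠ q) (hp : p ∈ m s(v, d)) (hq : q ∈ m s(v, d))
      (hp' : p ∈ m s(v, b)) (hq' : q ∈ m s(v, b)) : d = b :=
    Sym2.congr_right.1 (hm.eq_of_mem (e := s(v, d)) (f := s(v, b)) hd hb hpq hp hq hp' hq')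
  have hC {p q} (hpq : p ≠ q) (hp : p ∈ m s(v, d)) (hq : q ∈ m s(v, d))
      (hp' : p ∈ m s(v, c)) (hq' : q ∈ m s(v, c)) : d = c :=
    Sym2.congr_right.1 (hm.eq_of_mem (e := s(v, d)) (f := s(v, c)) hd hc hpq hp hq hp' hq')
  simp only [ha', hb', hc', Sym2.mem_iff] at *
  grind

/-- If a claw at `v` is mapped to a triangle and `H` has a further edge `ab`, then `H` has only the
vertices of the claw; exchanging the images of `vc` and `ab` then yields a map that is induced by
an injective map of the vertices. -/
theorem exists_injective_of_triangle (hm : IsLineGraphMap H m) (hH : H.Connected) {v a b c : V}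
    {x y z : X} (ha : H.Adj v a) (hb : H.Adj v b) (hc : H.Adj v c) (hab : H.Adj a b)
    (hac : a ≠ c) (hbc : b ≠ c) (hxy : x ≠ y) (hxz : x ≠ z) (hyz : y ≠ z)
    (ha' : m s(v, a) = s(y, z)) (hb' : m s(v, b) = s(x, z)) (hc' : m s(v, c) = s(x, y)) :
    ∃ ψ : V → X, Function.Injective ψ ∧
      ∀ x y, H.Adj x y → s(ψ x, ψ y) ∈ m '' H.edgeSet := by
  classical
  have hall : ∀ w, w = v ∨ w = a ∨ w = b ∨ w = c := by
    refine hH.mem_of_closed (S := {w | w = v ∨ w = a ∨ w = b ∨ w = c}) (v := v) (Or.inl rfl) ?_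
    rintro w (rfl | rfl | rfl | rfl) d hd
    · exact Or.inr (hm.eq_of_adj_center_of_triangle ha hb hc hxy hxz hyz ha' hb' hc' hd)
    · have := hm.eq_of_adj_of_triangle ha hb hc hab.ne hac ha' hb' hc' hd
      simp only [Set.mem_ofPred_eq]
      tauto
    · have := hm.eq_of_adj_of_triangle hb ha hc hab.ne' hbc hb' ha' (hc'.trans Sym2.eq_swap) hd
      simp only [Set.mem_ofPred_eq]
      tauto
    · have := hm.eq_of_adj_of_triangle hc ha hb hac.symm hbc.symm hc' (ha'.trans Sym2.eq_swap)
        (hb'.trans Sym2.eq_swap) hd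
      simp only [Set.mem_ofPred_eq]
      tauto
  -- The edges `ab` and `vc` are independent, so their images are disjoint. Hence `ab` meets the
  -- image of `va` in `z`, and its image is `z` with a new element `q`.
  have hn : ∀ p, p ∈ m s(a, b) → p ≠ x ∧ p ≠ y := by
    intro p hp
    have := mt (fun h ↦ (hm.meet_mk_iff hab hc).1 ⟨p, hp, h⟩)
      (by have := ha.ne; have := hb.ne; grind)
    rw [hc'] at this
    simpa using this
  have hz : z ∈ m s(a, b) := by
    obtain ⟨p, hp, hp'⟩ := (hm.meet_mk_iff hab ha).2 (by simp)
    have := hn p hp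
    rw [ha', Sym2.mem_iff] at hp'
    grind
  obtain ⟨q, hq⟩ := hz
  have hqz : q ≠ z := by
    rintro rfl
    exact hm.not_isDiag s(a, b) hab (by rw [hq]; simp)
  obtain ⟨hqx, hqy⟩ := hn q (by rw [hq]; simp)
  have hedge : ∀ {s t : V} {p r : X}, H.Adj s t → p ≠ r → p ∈ m s(s, t) → r ∈ m s(s, t) →
      s(p, r) ∈ m '' H.edgeSet := fun {s t p r} hst hpr hp hr ↦
    ⟨s(s, t), hst, (Sym2.mem_and_mem_iff hpr).1 ⟨hp, hr⟩⟩
  -- The image of `bc` avoids `y` and `z`, since `bc` is independent of `va`. It meets the images of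
  -- `vb` and `ab`, so it contains `x` and `q`.
  have hbc' : H.Adj b c → s(x, q) ∈ m '' H.edgeSet := by
    intro h
    have hne : ∀ p, p ∈ m s(b, c) → p ∉ m s(v, a) := fun p hp hp' ↦ by
      have := (hm.meet_mk_iff h ha).1 ⟨p, hp, hp'⟩
      have := hb.ne; have := hc.ne; have := hab.ne
      grind
    obtain ⟨p, hp, hp'⟩ := (hm.meet_mk_iff h hb).2 (by simp)
    obtain ⟨r, hr, hr'⟩ := (hm.meet_mk_iff h hab).2 (by simp)
    have h1 := hne p hp
    have h2 := hne r hr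
    rw [ha', Sym2.mem_iff] at h1 h2
    rw [hb', Sym2.mem_iff] at hp'
    rw [hq, Sym2.mem_iff] at hr'
    obtain rfl : p = x := by tauto
    obtain rfl : r = q := by tauto
    exact hedge h hqx.symm hp hr
  have hac' : H.Adj a c → s(y, q) ∈ m '' H.edgeSet := by
    intro h
    have hne : ∀ p, p ∈ m s(a, c) → p ∉ m s(v, b) := fun p hp hp' ↦ by
      have := (hm.meet_mk_iff h hb).1 ⟨p, hp, hp'⟩
      have := ha.ne; have := hc.ne; have := hab.ne
      grind
    obtain ⟨p, hp, hp'⟩ := (hm.meet_mk_iff h ha).2 (by simp)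
    obtain ⟨r, hr, hr'⟩ := (hm.meet_mk_iff h hab).2 (by simp)
    have h1 := hne p hp
    have h2 := hne r hr
    rw [hb', Sym2.mem_iff] at h1 h2
    rw [ha', Sym2.mem_iff] at hp'
    rw [hq, Sym2.mem_iff] at hr'
    obtain rfl : p = y := by tauto
    obtain rfl : r = q := by tauto
    exact hedge h hqy.symm hp hr
  have e1 : s(y, z) ∈ m '' H.edgeSet := ⟨s(v, a), ha, ha'⟩
  have e2 : s(x, z) ∈ m '' H.edgeSet := ⟨s(v, b), hb, hb'⟩
  have e3 : s(x, y) ∈ m '' H.edgeSet := ⟨s(v, c), hc, hc'⟩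
  have e4 : s(z, q) ∈ m '' H.edgeSet := ⟨s(a, b), hab, hq⟩
  have e1' := Sym2.eq_swap ▸ e1
  have e2' := Sym2.eq_swap ▸ e2
  have e3' := Sym2.eq_swap ▸ e3
  have e4' := Sym2.eq_swap ▸ e4
  let ψ : V → X := fun w ↦ if w = v then z else if w = a then y else if w = b then x else q
  have ψv : ψ v = z := if_pos rfl
  have ψa : ψ a = y := by simp [ψ, ha.ne']
  have ψb : ψ b = x := by simp [ψ, hb.ne', hab.ne']
  have ψc : ψ c = q := by simp [ψ, hc.ne', hac.symm, hbc.symm]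
  refine ⟨ψ, ?_, ?_⟩
  · intro s t hst
    rcases hall s with rfl | rfl | rfl | rfl <;> rcases hall t with rfl | rfl | rfl | rfl <;>
      first | rfl | (simp only [ψv, ψa, ψb, ψc] at hst; exfalso; grind)
  · intro s t hst
    rcases hall s with rfl | rfl | rfl | rfl <;> rcases hall t with rfl | rfl | rfl | rfl <;>
      first
      | exact (hst.ne rfl).elim
      | (simp only [ψv, ψa, ψb, ψc]
         first
         | assumption
         | exact hbc' hst
         | exact hac' hst
         | exact Sym2.eq_swap ▸ hbc' hst.symm
         | exact Sym2.eq_swap ▸ hac' hst.symm)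

/-- A weak form of Whitney's theorem: a connected graph with a twin-free line graph and at least
four edges is, up to isomorphism, a subgraph of every graph with the same line graph. -/
theorem exists_injective (hm : IsLineGraphMap H m) (hH : H.Connected)
    (hE : ∀ e₁ e₂ e₃ : Sym2 V, ∃ e ∈ H.edgeSet, e ≠ e₁ ∧ e ≠ e₂ ∧ e ≠ e₃) :
    ∃ ψ : V → X, Function.Injective ψ ∧
      ∀ x y, H.Adj x y → s(ψ x, ψ y) ∈ m '' H.edgeSet := by
  by_cases hclaw : ∀ v a b c, H.Adj v a → H.Adj v b → H.Adj v c → a ≠ b → a ≠ c → b ≠ c →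
      ∃ p, p ∈ m s(v, a) ∧ p ∈ m s(v, b) ∧ p ∈ m s(v, c)
  · exact hm.exists_injective_of_claw hH hE hclaw
  · simp only [not_forall] at hclaw
    obtain ⟨v, a, b, c, ha, hb, hc, hab, hac, hbc, hn⟩ := hclaw
    obtain ⟨x, y, z, hxy, hxz, hyz, ha', hb', hc'⟩ := hm.exists_triangle ha hb hc hn
    have hA := fun d ↦ hm.eq_of_adj_of_triangle (d := d) ha hb hc hab hac ha' hb' hc'
    have hB := fun d ↦ hm.eq_of_adj_of_triangle (d := d) hb ha hc hab.symm hbc hb' ha'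
      (hc'.trans Sym2.eq_swap)
    have hC := fun d ↦ hm.eq_of_adj_of_triangle (d := d) hc ha hb hac.symm hbc.symm hc'
      (ha'.trans Sym2.eq_swap) (hb'.trans Sym2.eq_swap)
    have hV := fun d ↦ hm.eq_of_adj_center_of_triangle (d := d) ha hb hc hxy hxz hyz ha' hb' hc'
    by_cases h1 : H.Adj a b
    · exact hm.exists_injective_of_triangle hH ha hb hc h1 hac hbc hxy hxz hyz ha' hb' hc'
    by_cases h2 : H.Adj b c
    · exact hm.exists_injective_of_triangle hH hb hc ha h2 hab.symm hac.symm hyz hxy.symm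
        hxz.symm (hb'.trans Sym2.eq_swap) (hc'.trans Sym2.eq_swap) ha'
    by_cases h3 : H.Adj c a
    · exact hm.exists_injective_of_triangle hH hc ha hb h3 hbc.symm hab hxz.symm hyz.symm hxy
        hc' (ha'.trans Sym2.eq_swap) (hb'.trans Sym2.eq_swap)
    -- With no edge among `a`, `b`, `c`, the graph is the claw itself and has only three edges.
    have hall : ∀ w, w = v ∨ w = a ∨ w = b ∨ w = c := by
      refine hH.mem_of_closed (S := {w | w = v ∨ w = a ∨ w = b ∨ w = c}) (v := v) (Or.inl rfl) ?_
      rintro w (rfl | rfl | rfl | rfl) d hd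
      · exact Or.inr (hV d hd)
      · have := hA d hd
        simp only [Set.mem_ofPred_eq]; tauto
      · have := hB d hd
        simp only [Set.mem_ofPred_eq]; tauto
      · have := hC d hd
        simp only [Set.mem_ofPred_eq]; tauto
    obtain ⟨e, he, hea, heb, hec⟩ := hE s(v, a) s(v, b) s(v, c)
    induction e with
    | h s t =>
      have hst : H.Adj s t := he
      have hst' := hst.symm
      have hne := hst.ne
      simp only [ne_eq, Sym2.eq_iff] at hea heb hec
      exfalso
      rcases hall s with rfl | rfl | rfl | rfl <;> rcases hall t with rfl | rfl | rfl | rfl <;>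
        simp_all

end IsLineGraphMap

/-! ### Paths in trees -/

namespace SimpleGraph

variable {W A : Type*} {T : SimpleGraph W}

/-- The vertices on all walks from `x` to `y`. In a tree these are the vertices on the path from
`x` to `y`. -/
def pathVerts (T : SimpleGraph W) (x y : W) : Set W :=
  {w | ∀ p : T.Walk x y, w ∈ p.support}

theorem pathVerts_comm (x y : W) : T.pathVerts x y = T.pathVerts y x := by
  ext w
  exact ⟨fun h p ↦ by simpa using h p.reverse, fun h p ↦ by simpa using h p.reverse⟩

theorem IsAcyclic.pathVerts_eq (hT : T.IsAcyclic) {x y : W} {p : T.Walk x y} (hp : p.IsPath) :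
    T.pathVerts x y = {w | w ∈ p.support} := by
  classical
  ext w
  refine ⟨fun h ↦ h p, fun h q ↦ ?_⟩
  have := (hT.subsingleton_path x y).elim ⟨p, hp⟩ q.toPath
  have h1 : p = (q.toPath : T.Walk x y) := congrArg Subtype.val this
  have h2 : w ∈ p.support := h
  rw [h1] at h2
  exact q.support_toPath_subset_support h2

theorem IsAcyclic.pathVerts_map {W' : Type*} {T' : SimpleGraph W'} (hT' : T'.IsAcyclic)
    (g : T →g T') (hg : Function.Injective g) (hT : T.IsTree) (x y : W) :
    T'.pathVerts (g x) (g y) = g '' T.pathVerts x y := by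
  obtain ⟨p, hp, -⟩ := hT.existsUnique_path x y
  rw [hT.isAcyclic.pathVerts_eq hp, hT'.pathVerts_eq (hp.map hg)]
  ext w
  simp

theorem Subgraph.pathVerts_subset {S : T.Subgraph} (hS : S.coe.Connected) {x y : W}
    (hx : x ∈ S.verts) (hy : y ∈ S.verts) : T.pathVerts x y ⊆ S.verts := by
  intro w hw
  obtain ⟨p⟩ := hS.preconnected ⟨x, hx⟩ ⟨y, hy⟩
  have h : w ∈ (p.map S.hom).support := hw (p.map S.hom)
  obtain ⟨z, -, rfl⟩ := List.mem_map.1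
    (Eq.subst (motive := fun l ↦ w ∈ l) (p.support_map S.hom) h)
  exact z.2

/-- A path as a subtree of a tree. -/
theorem IsTree.exists_subgraph_pathVerts [Finite W] (hT : T.IsTree) (x y : W) :
    ∃ S : T.Subgraph, S.verts = T.pathVerts x y ∧ S.coe.IsTree ∧
      (∀ w ∈ S.verts, (S.neighborSet w).ncard ≤ 2) ∧
      ∀ w, (IsSubtreeLeaf S w ∨ w ∈ S.verts ∧ IsLeaf T w) → w = x ∨ w = y := by
  obtain ⟨p, hp, -⟩ := hT.existsUnique_path x y
  have key : ∀ w ∈ p.toSubgraph.verts,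
      w = x ∨ w = y ∨ (p.toSubgraph.neighborSet w).ncard = 2 := by
    intro w hw
    rw [Walk.mem_verts_toSubgraph, Walk.mem_support_iff_exists_getVert] at hw
    obtain ⟨i, rfl, hi⟩ := hw
    rcases Nat.eq_zero_or_pos i with rfl | h0
    · simp
    rcases hi.eq_or_lt with rfl | hlt
    · simp
    · exact Or.inr (Or.inr (hp.ncard_neighborSet_toSubgraph_internal_eq_two h0.ne' hlt))
  have hle : ∀ w, (p.toSubgraph.neighborSet w).ncard ≤ (T.neighborSet w).ncard :=
    fun w ↦ Set.ncard_le_ncard (p.toSubgraph.neighborSet_subset w) (Set.toFinite _)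
  refine ⟨p.toSubgraph, ?_, ⟨p.toSubgraph_connected, hT.isAcyclic.subgraph _⟩, ?_, ?_⟩
  · rw [hT.isAcyclic.pathVerts_eq hp, Walk.verts_toSubgraph]
  · intro w hw
    by_cases hnil : p.Nil
    · have : p.toSubgraph.neighborSet w = ∅ := by
        cases hnil
        ext z
        simp
      simp [this]
    · rcases key w hw with rfl | rfl | h
      · rw [hp.neighborSet_toSubgraph_startpoint hnil]; simp
      · rw [hp.neighborSet_toSubgraph_endpoint hnil]; simp
      · exact h.le
  · rintro w (⟨hw, h⟩ | ⟨hw, h⟩)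
    · rcases key w hw with h' | h' | h'
      · exact Or.inl h'
      · exact Or.inr h'
      · omega
    · rcases key w hw with h' | h' | h'
      · exact Or.inl h'
      · exact Or.inr h'
      · have := hle w
        have : (T.neighborSet w).ncard ≤ 1 := h
        omega

/-- A finite tree of maximum degree at most two has at most two leaves. -/
theorem Subgraph.exists_isSubtreeLeaf_iff [Finite W] {S : T.Subgraph} (hS : S.coe.IsTree)
    (hdeg : ∀ w ∈ S.verts, (S.neighborSet w).ncard ≤ 2) :
    ∃ a b, ∀ w, IsSubtreeLeaf S w ↔ w = a ∨ w = b := by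
  classical
  have := Fintype.ofFinite S.verts
  have hd : ∀ (w : S.verts) [Fintype (S.coe.neighborSet w)],
      S.coe.degree w = (S.neighborSet w).ncard := by
    intro w _
    have h1 : Subtype.val '' S.coe.neighborSet w = S.neighborSet w := by
      ext z
      simp only [Set.mem_image, mem_neighborSet, Subgraph.mem_neighborSet]
      exact ⟨fun ⟨y, h, hy⟩ ↦ hy ▸ h, fun h ↦ ⟨⟨z, S.edge_vert h.symm⟩, h, rfl⟩⟩
    rw [← h1, Set.ncard_image_of_injective _ Subtype.val_injective, Set.ncard_eq_toFinset_card']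
    rfl
  obtain ⟨r⟩ := hS.connected.nonempty
  by_cases hsub : Subsingleton S.verts
  · refine ⟨r, r, fun w ↦ ⟨fun h ↦ ?_, ?_⟩⟩
    · exact Or.inl (congrArg Subtype.val (Subsingleton.elim (⟨w, h.1⟩ : S.verts) r))
    · rw [or_self]
      rintro rfl
      refine ⟨r.2, ?_⟩
      have : S.neighborSet r = ∅ := by
        ext z
        simp only [Subgraph.mem_neighborSet, Set.mem_empty_iff_false, iff_false]
        intro h
        exact h.ne (congrArg Subtype.val (Subsingleton.elim r ⟨z, S.edge_vert h.symm⟩))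
      simp [this]
  · have : Nontrivial S.verts := not_subsingleton_iff_nontrivial.1 hsub
    have hpos : ∀ w : S.verts, 0 < (S.neighborSet w).ncard := fun w ↦
      hd w ▸ hS.connected.preconnected.degree_pos_of_nontrivial w
    have hle : ∀ w : S.verts, (S.neighborSet w).ncard ≤ 2 := fun w ↦ hdeg w w.2
    have hsum := S.coe.sum_degrees_eq_twice_card_edges
    have hcard := hS.card_edgeFinset
    simp only [hd] at hsum
    -- All degrees are 1 or 2 and they sum to twice the order minus two, so exactly two vertices
    -- have degree 1.
    have hcount : ∑ w : S.verts, ((S.neighborSet w).ncard +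
        if (S.neighborSet w).ncard = 1 then 1 else 0) = ∑ _w : S.verts, 2 := by
      refine Finset.sum_congr rfl fun w _ ↦ ?_
      have := hpos w
      have := hle w
      split_ifs <;> omega
    rw [Finset.sum_add_distrib, ← Finset.card_filter, Finset.sum_const, Finset.card_univ,
      smul_eq_mul, hsum] at hcount
    have h2 : (Finset.univ.filter fun w : S.verts ↦ (S.neighborSet w).ncard = 1).card = 2 := by
      omega
    obtain ⟨a, b, -, hab⟩ := Finset.card_eq_two.1 h2
    refine ⟨a, b, fun w ↦ ?_⟩
    have hiff : ∀ w : S.verts, (S.neighborSet w).ncard = 1 ↔ w = a ∨ w = b := fun w ↦ by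
      simpa using Finset.ext_iff.1 hab w
    refine ⟨fun ⟨hw, h⟩ ↦ ?_, ?_⟩
    · have := (hiff ⟨w, hw⟩).1 (le_antisymm h (hpos ⟨w, hw⟩))
      simpa [Subtype.ext_iff] using this
    · rintro (rfl | rfl)
      · exact ⟨a.2, ((hiff a).2 (Or.inl rfl)).le⟩
      · exact ⟨b.2, ((hiff b).2 (Or.inr rfl)).le⟩

/-! ### Attaching leaves to a tree -/

/-- The graph obtained from `T` by attaching a new leaf `a` to the vertex `f a` for all `a`. -/
def attachLeaves (T : SimpleGraph W) (f : A → W) : SimpleGraph (W ⊕ A) where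
  Adj
    | .inl x, .inl y => T.Adj x y
    | .inl x, .inr a => f a = x
    | .inr a, .inl x => f a = x
    | .inr _, .inr _ => False
  symm := ⟨by
    rintro (x | a) (y | b) h
    · exact SimpleGraph.Adj.symm h
    · exact h
    · exact h
    · exact h⟩
  loopless := ⟨by
    rintro (x | a) h
    · exact T.loopless.irrefl x h
    · exact h⟩

section attachLeaves

variable (f : A → W)

/-- The inclusion of `T` in the graph with leaves attached. -/
def attachLeavesHom (T : SimpleGraph W) (f : A → W) : T →g T.attachLeaves f where
  toFun := Sum.inl
  map_rel' h := h

theorem attachLeaves_adj_inr (a : A) : (T.attachLeaves f).Adj (Sum.inr a) (Sum.inl (f a)) := rfl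

theorem Connected.attachLeaves (hT : T.Connected) : (T.attachLeaves f).Connected := by
  obtain ⟨r⟩ := hT.nonempty
  have hl : ∀ x y, (T.attachLeaves f).Reachable (Sum.inl x) (Sum.inl y) :=
    fun x y ↦ (hT.preconnected x y).map (attachLeavesHom T f)
  have h : ∀ z, (T.attachLeaves f).Reachable (Sum.inl r) z := by
    rintro (x | a)
    · exact hl r x
    · exact (hl r (f a)).trans (attachLeaves_adj_inr f a).reachable.symm
  exact (connected_iff _).2 ⟨fun x y ↦ (h x).symm.trans (h y), ⟨Sum.inl r⟩⟩

theorem IsTree.attachLeaves [Finite W] [Finite A] (hT : T.IsTree) :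
    (T.attachLeaves f).IsTree := by
  rw [isTree_iff_connected_and_card] at hT ⊢
  have hconn := hT.1.attachLeaves f
  refine ⟨hconn, le_antisymm ?_ hconn.card_vert_le_card_edgeSet_add_one⟩
  have hsub : (T.attachLeaves f).edgeSet ⊆ (Sym2.map Sum.inl '' T.edgeSet) ∪
      Set.range fun a ↦ s(Sum.inl (f a), Sum.inr a) := by
    intro e he
    induction e with
    | h x y =>
      rcases x with x | a <;> rcases y with y | b
      · exact Or.inl ⟨s(x, y), he, rfl⟩
      · obtain rfl : f b = x := he
        exact Or.inr ⟨b, rfl⟩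
      · obtain rfl : f a = y := he
        exact Or.inr ⟨a, Sym2.eq_swap⟩
      · exact he.elim
  have h1 := (Set.ncard_le_ncard hsub (Set.toFinite _)).trans (Set.ncard_union_le _ _)
  have h2 := Set.ncard_image_le (f := Sym2.map (Sum.inl : W → W ⊕ A)) (Set.toFinite T.edgeSet)
  have h3 : (Set.range fun a ↦ s((Sum.inl (f a) : W ⊕ A), Sum.inr a)).ncard ≤ Nat.card A := by
    rw [← Set.image_univ, ← Set.ncard_univ]
    exact Set.ncard_image_le (Set.toFinite _)
  have h4 := hT.2
  rw [Nat.card_coe_set_eq] at h4 ⊢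
  rw [Nat.card_sum]
  omega

theorem isLeaf_attachLeaves_inr (a : A) : IsLeaf (T.attachLeaves f) (Sum.inr a) := by
  have : (T.attachLeaves f).neighborSet (Sum.inr a) = {Sum.inl (f a)} := by
    ext (x | b)
    · simp only [mem_neighborSet, Set.mem_singleton_iff, Sum.inl.injEq]
      exact eq_comm
    · simp only [mem_neighborSet, Set.mem_singleton_iff, reduceCtorEq, iff_false]
      exact fun h ↦ h
  unfold IsLeaf
  rw [this, Set.ncard_singleton]

theorem ncard_neighborSet_attachLeaves_inl_le [Finite W] [Finite A] (x : W) :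
    ((T.attachLeaves f).neighborSet (Sum.inl x)).ncard ≤
      (T.neighborSet x).ncard + (f ⁻¹' {x}).ncard := by
  have hsub : (T.attachLeaves f).neighborSet (Sum.inl x) ⊆
      Sum.inl '' T.neighborSet x ∪ Sum.inr '' (f ⁻¹' {x}) := by
    rintro (y | b) h
    · exact Or.inl ⟨y, h, rfl⟩
    · exact Or.inr ⟨b, h, rfl⟩
  refine (Set.ncard_le_ncard hsub (Set.toFinite _)).trans ((Set.ncard_union_le _ _).trans ?_)
  exact add_le_add (Set.ncard_image_le (Set.toFinite _)) (Set.ncard_image_le (Set.toFinite _))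

/-- Only leaves of `T` receive new neighbours, at most two each, so their degree is at most `1 + 2 ≤
h`. This is where `3 ≤ h` is needed. -/
theorem ncard_neighborSet_attachLeaves_le [Finite W] [Finite A] {h : ℕ} (hh : 3 ≤ h)
    (hdeg : ∀ w, (T.neighborSet w).ncard ≤ h) (hf : ∀ a, IsLeaf T (f a))
    (hf2 : ∀ x, (f ⁻¹' {x}).ncard ≤ 2) (z : W ⊕ A) :
    ((T.attachLeaves f).neighborSet z).ncard ≤ h := by
  rcases z with x | a
  · refine (ncard_neighborSet_attachLeaves_inl_le f x).trans ?_
    have h2 := hf2 x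
    by_cases hx : IsLeaf T x
    · have : (T.neighborSet x).ncard ≤ 1 := hx
      omega
    · have : f ⁻¹' {x} = ∅ := by
        ext a
        simp only [Set.mem_preimage, Set.mem_singleton_iff, Set.mem_empty_iff_false, iff_false]
        rintro rfl
        exact hx (hf a)
      rw [this, Set.ncard_empty]
      exact hdeg x
  · exact (isLeaf_attachLeaves_inr f a).trans (by omega)

theorem IsTree.pathVerts_attachLeaves [Finite W] [Finite A] (hT : T.IsTree) {a b : A}
    (hab : a ≠ b) :
    (T.attachLeaves f).pathVerts (Sum.inr a) (Sum.inr b) =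
      {Sum.inr a, Sum.inr b} ∪ Sum.inl '' T.pathVerts (f a) (f b) := by
  obtain ⟨p, hp, -⟩ := hT.existsUnique_path (f a) (f b)
  have hq := hp.map (f := attachLeavesHom T f) Sum.inl_injective
  have hq' := hq.concat (w := Sum.inr b)
    (by simp [attachLeavesHom]) (attachLeaves_adj_inr f b).symm
  have hq'' := hq'.cons (u := Sum.inr a)
    (by simp [Walk.support_concat, attachLeavesHom, hab]) (h := attachLeaves_adj_inr f a)
  rw [hT.isAcyclic.pathVerts_eq hp, (hT.attachLeaves f).isAcyclic.pathVerts_eq hq'']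
  ext w
  simp only [Walk.support_cons, Walk.support_concat, Walk.support_map, attachLeavesHom]
  simp only [List.mem_cons, List.mem_append, List.mem_map, Set.mem_union,
    Set.mem_insert_iff, Set.mem_singleton_iff, Set.mem_image, Set.mem_ofPred_eq, List.not_mem_nil,
    or_false]
  exact (or_congr_right or_comm).trans or_assoc.symm

/-- The only new vertices of the two paths are their ends, and these are four different leaves. -/
theorem IsTree.ncard_inter_pathVerts_attachLeaves_le [Finite W] [Finite A] (hT : T.IsTree)
    {a b a' b' : A} (hab : a ≠ b) (hab' : a' ≠ b') (h1 : a ≠ a') (h2 : a ≠ b') (h3 : b ≠ a')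
    (h4 : b ≠ b') :
    ((T.attachLeaves f).pathVerts (Sum.inr a) (Sum.inr b) ∩
      (T.attachLeaves f).pathVerts (Sum.inr a') (Sum.inr b')).ncard ≤
    (T.pathVerts (f a) (f b) ∩ T.pathVerts (f a') (f b')).ncard := by
  rw [hT.pathVerts_attachLeaves f hab, hT.pathVerts_attachLeaves f hab',
    ← Set.ncard_image_of_injective (T.pathVerts (f a) (f b) ∩ T.pathVerts (f a') (f b'))
      (Sum.inl_injective (β := A))]
  refine Set.ncard_le_ncard ?_ (Set.toFinite _)
  rintro (w | c) ⟨h, h'⟩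
  · simp only [Set.mem_union, Set.mem_insert_iff, reduceCtorEq, Set.mem_singleton_iff,
      or_self, Set.mem_image, Sum.inl.injEq, exists_eq_right, false_or] at h h'
    exact ⟨w, ⟨h, h'⟩, rfl⟩
  · simp only [Set.mem_union, Set.mem_insert_iff, Sum.inr.injEq, Set.mem_singleton_iff,
      Set.mem_image, reduceCtorEq, and_false, exists_false, or_false] at h h'
    grind

end attachLeaves

end SimpleGraph

/-! ### Pruning and lengthening tree layouts -/

/-- A tree layout whose host tree may have leaves that do not represent vertices of `H`. -/
structure IsLooseTreeLayout {V W : Type*} (h t : ℕ) (H : SimpleGraph V) (T : SimpleGraph W)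
    (φ : V → W) : Prop where
  isTree : T.IsTree
  degree_le : ∀ w : W, (T.neighborSet w).ncard ≤ h
  injective : Function.Injective φ
  isLeaf : ∀ v, IsLeaf T (φ v)
  inter_le : ∀ x y x' y' : V, H.Adj x y → H.Adj x' y' →
    x ≠ x' → x ≠ y' → y ≠ x' → y ≠ y' →
    (T.pathVerts (φ x) (φ y) ∩ T.pathVerts (φ x') (φ y')).ncard ≤ t - 1

theorem IsTreeLayout.isLooseTreeLayout {V W : Type*} {h t : ℕ} {H : SimpleGraph V}
    {T : SimpleGraph W} {φ : V → W} (hT : IsTreeLayout h t H T φ) (hh : 1 ≤ h) :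
    IsLooseTreeLayout h t H T φ where
  isTree := hT.isTree
  degree_le w := by
    by_cases hw : IsLeaf T w
    · exact le_trans hw hh
    · exact hT.internal_degree_le w hw
  injective := hT.injective
  isLeaf v := by
    have : φ v ∈ {w | IsLeaf T w} := hT.range_eq ▸ Set.mem_range_self v
    exact this
  inter_le x y x' y' hxy hxy' h1 h2 h3 h4 := by
    obtain ⟨p, hp, -⟩ := hT.isTree.existsUnique_path (φ x) (φ y)
    obtain ⟨q, hq, -⟩ := hT.isTree.existsUnique_path (φ x') (φ y')
    rw [hT.isTree.isAcyclic.pathVerts_eq hp, hT.isTree.isAcyclic.pathVerts_eq hq]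
    exact hT.inter_le x y x' y' hxy hxy' h1 h2 h3 h4 p q hp hq

namespace IsLooseTreeLayout

variable {V W : Type*} {h t : ℕ} {H : SimpleGraph V} {T : SimpleGraph W} {φ : V → W}

/-- Deleting a superfluous leaf of the host tree. -/
theorem induce_compl_singleton [Finite W] (hT : IsLooseTreeLayout h t H T φ) [Nontrivial W] {w : W}
    (hw : IsLeaf T w) (hφ : ∀ v, φ v ≠ w) :
    IsLooseTreeLayout h t H (T.induce {w}ᶜ) (fun v ↦ ⟨φ v, hφ v⟩) := by
  classical
  have := Fintype.ofFinite W
  have hdeg : T.degree w = 1 := by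
    refine le_antisymm ?_ (hT.isTree.connected.preconnected.degree_pos_of_nontrivial w)
    have : (T.neighborSet w).ncard ≤ 1 := hw
    rwa [Set.ncard_eq_toFinset_card', Set.toFinset_card, card_neighborSet_eq_degree] at this
  have htree : (T.induce {w}ᶜ).IsTree :=
    ⟨hT.isTree.connected.induce_compl_singleton_of_degree_eq_one hdeg,
      hT.isTree.isAcyclic.induce _⟩
  have hle : ∀ x : ({w}ᶜ : Set W),
      ((T.induce {w}ᶜ).neighborSet x).ncard ≤ (T.neighborSet x).ncard := by
    intro x
    rw [← Set.ncard_image_of_injective _ Subtype.val_injective]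
    refine Set.ncard_le_ncard ?_ (Set.toFinite _)
    rintro _ ⟨y, hy, rfl⟩
    exact hy
  refine ⟨htree, fun x ↦ (hle x).trans (hT.degree_le x), fun x y hxy ↦ ?_,
    fun v ↦ (hle _).trans (hT.isLeaf v), ?_⟩
  · exact hT.injective (congrArg Subtype.val hxy)
  · intro x y x' y' hxy hxy' h1 h2 h3 h4
    have := hT.inter_le x y x' y' hxy hxy' h1 h2 h3 h4
    have hmap := hT.isTree.isAcyclic.pathVerts_map (Embedding.induce {w}ᶜ).toHom
      Subtype.val_injective htree
    have e1 := hmap ⟨φ x, hφ x⟩ ⟨φ y, hφ y⟩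
    have e2 := hmap ⟨φ x', hφ x'⟩ ⟨φ y', hφ y'⟩
    change T.pathVerts (φ x) (φ y) = Subtype.val '' _ at e1
    change T.pathVerts (φ x') (φ y') = Subtype.val '' _ at e2
    rw [e1, e2, ← Set.image_inter Subtype.val_injective,
      Set.ncard_image_of_injective _ Subtype.val_injective] at this
    exact this

/-- All superfluous leaves of the host tree can be deleted. -/
theorem exists_isTreeLayout [Nontrivial V] {W : Type} [Finite W] {T : SimpleGraph W} {φ : V → W}
    (hT : IsLooseTreeLayout h t H T φ) :
    ∃ (W : Type) (_ : Finite W) (T : SimpleGraph W) (φ : V → W), IsTreeLayout h t H T φ := by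
  -- Deleting a leaf may turn its neighbour into another superfluous leaf, hence the induction on
  -- the order of the host tree.
  induction hn : Nat.card W using Nat.strong_induction_on generalizing W with
  | _ n ih =>
    by_cases hr : ∃ w, IsLeaf T w ∧ ∀ v, φ v ≠ w
    · obtain ⟨w, hw, hφ⟩ := hr
      have : Nontrivial W := hT.injective.nontrivial
      refine ih _ ?_ (hT.induce_compl_singleton hw hφ) rfl
      rw [← hn]
      exact Finite.card_subtype_lt (x := w) (by simp)
    · push Not at hr
      refine ⟨W, inferInstance, T, φ, hT.isTree, fun w _ ↦ hT.degree_le w, hT.injective, ?_, ?_⟩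
      · ext w
        refine ⟨?_, hr w⟩
        rintro ⟨v, rfl⟩
        exact hT.isLeaf v
      · intro x y x' y' hxy hxy' h1 h2 h3 h4 p q hp hq
        have := hT.inter_le x y x' y' hxy hxy' h1 h2 h3 h4
        rwa [hT.isTree.isAcyclic.pathVerts_eq hp, hT.isTree.isAcyclic.pathVerts_eq hq] at this

/-- Lengthening all pendant branches by one vertex. -/
theorem attachLeaves [Finite W] (hT : IsLooseTreeLayout h t H T φ) (hh : 3 ≤ h) :
    IsLooseTreeLayout h t H (T.attachLeaves (Subtype.val : Set.range φ → W))
      (fun v ↦ Sum.inr ⟨φ v, Set.mem_range_self v⟩) where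
  isTree := hT.isTree.attachLeaves _
  degree_le := by
    refine ncard_neighborSet_attachLeaves_le _ hh hT.degree_le ?_ fun x ↦ ?_
    · rintro ⟨_, v, rfl⟩
      exact hT.isLeaf v
    · refine le_trans ?_ one_le_two
      refine Set.ncard_le_one_iff_subsingleton.2 ?_
      exact Set.subsingleton_singleton.preimage Subtype.val_injective
  injective x y hxy := hT.injective (congrArg Subtype.val (Sum.inr_injective hxy))
  isLeaf v := isLeaf_attachLeaves_inr _ _
  inter_le x y x' y' hxy hxy' h1 h2 h3 h4 := by
    have hne : ∀ {v w : V}, v ≠ w → (⟨φ v, Set.mem_range_self v⟩ : Set.range φ) ≠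
        ⟨φ w, Set.mem_range_self w⟩ := fun h e ↦ h (hT.injective (congrArg Subtype.val e))
    exact (hT.isTree.ncard_inter_pathVerts_attachLeaves_le _ (hne hxy.ne) (hne hxy'.ne) (hne h1)
      (hne h2) (hne h3) (hne h4)).trans (hT.inter_le x y x' y' hxy hxy' h1 h2 h3 h4)

/-- Each lengthening adds the new leaf of `x` to both paths starting there, so `k` rounds yield `k`
common vertices. -/
theorem exists_le_ncard_inter {W : Type} [Finite W] {T : SimpleGraph W} {φ : V → W}
    (hT : IsLooseTreeLayout h t H T φ) (hh : 3 ≤ h) (k : ℕ) :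
    ∃ (W : Type) (_ : Finite W) (T : SimpleGraph W) (φ : V → W), IsLooseTreeLayout h t H T φ ∧
      ∀ x y y', H.Adj x y → H.Adj x y' →
        k ≤ (T.pathVerts (φ x) (φ y) ∩ T.pathVerts (φ x) (φ y')).ncard := by
  induction k with
  | zero => exact ⟨W, inferInstance, T, φ, hT, fun _ _ _ _ _ ↦ Nat.zero_le _⟩
  | succ k ih =>
    obtain ⟨W, _, T, φ, hT, hk⟩ := ih
    refine ⟨_, inferInstance, _, _, hT.attachLeaves hh, fun x y y' hxy hxy' ↦ ?_⟩
    have hne : ∀ {v w : V}, v ≠ w → (⟨φ v, Set.mem_range_self v⟩ : Set.range φ) ≠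
        ⟨φ w, Set.mem_range_self w⟩ := fun h e ↦ h (hT.injective (congrArg Subtype.val e))
    rw [hT.isTree.pathVerts_attachLeaves _ (hne hxy.ne),
      hT.isTree.pathVerts_attachLeaves _ (hne hxy'.ne)]
    refine le_trans (Nat.succ_le_succ (hk x y y' hxy hxy')) ?_
    rw [← Set.ncard_image_of_injective _ (Sum.inl_injective (β := Set.range φ)),
      Nat.succ_eq_add_one, ← Set.ncard_insert_of_notMem (a := Sum.inr ⟨φ x, Set.mem_range_self x⟩)
        (by simp) (Set.toFinite _)]
    refine Set.ncard_le_ncard ?_ (Set.toFinite _)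
    rintro _ (rfl | ⟨w, ⟨hw, hw'⟩, rfl⟩)
    · exact ⟨Or.inl (Or.inl rfl), Or.inl (Or.inl rfl)⟩
    · exact ⟨Or.inr ⟨w, hw, rfl⟩, Or.inr ⟨w, hw', rfl⟩⟩

end IsLooseTreeLayout

/-! ### Tree layouts and orthodox representations -/

theorem SimpleGraph.Iso.adj_lineGraph_iff {U V : Type*} {G : SimpleGraph U} {H : SimpleGraph V}
    (Φ : G ≃g H.lineGraph) {u v : U} (huv : u ≠ v) :
    G.Adj u v ↔ ∃ x, x ∈ (Φ u : Sym2 V) ∧ x ∈ (Φ v : Sym2 V) := by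
  rw [← Φ.map_adj_iff, lineGraph_adj_iff_exists]
  simp [huv]

/-- A tree layout yields an orthodox representation of the line graph. -/
theorem IsLooseTreeLayout.inORTH {U V W : Type*} [Finite W] {h t : ℕ} {G : SimpleGraph U}
    {H : SimpleGraph V} {T : SimpleGraph W} {φ : V → W} (Φ : G ≃g H.lineGraph) (ht : 1 ≤ t)
    (hT : IsLooseTreeLayout h t H T φ)
    (hadj : ∀ x y y', H.Adj x y → H.Adj x y' →
        t ≤ (T.pathVerts (φ x) (φ y) ∩ T.pathVerts (φ x) (φ y')).ncard) :
    ∃ S : U → T.Subgraph, IsOrthodoxRepresentation h 2 t G T S := by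
  have hS : ∀ u, ∃ S : T.Subgraph, S.coe.IsTree ∧
      (∀ w ∈ S.verts, (S.neighborSet w).ncard ≤ 2) ∧
      (∀ w, (IsSubtreeLeaf S w ∨ w ∈ S.verts ∧ IsLeaf T w) → ∃ x ∈ (Φ u : Sym2 V), w = φ x) ∧
      ∀ x ∈ (Φ u : Sym2 V), ∃ y, H.Adj x y ∧ (Φ u : Sym2 V) = s(x, y) ∧
        S.verts = T.pathVerts (φ x) (φ y) := by
    intro u
    obtain ⟨e, he⟩ := Φ u
    induction e with
    | h x y =>
      obtain ⟨S, h1, h2, h3, h4⟩ := hT.isTree.exists_subgraph_pathVerts (φ x) (φ y)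
      refine ⟨S, h2, h3, fun w hw ↦ ?_, fun z hz ↦ ?_⟩
      · rcases h4 w hw with h | h
        · exact ⟨x, by simp, h⟩
        · exact ⟨y, by simp, h⟩
      · rcases Sym2.mem_iff.1 hz with rfl | rfl
        · exact ⟨y, he, rfl, h1⟩
        · exact ⟨x, H.symm.symm _ _ he, Sym2.eq_swap, h1.trans (pathVerts_comm _ _)⟩
  choose S h1 h2 h3 h4 using hS
  have hmem : ∀ u, ∀ x ∈ (Φ u : Sym2 V), φ x ∈ (S u).verts := by
    intro u x hx
    obtain ⟨y, -, -, h⟩ := h4 u x hx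
    rw [h]
    exact fun p ↦ p.start_mem_support
  refine ⟨S, ⟨⟨hT.isTree, hT.degree_le, h1, h2, fun u v huv ↦ ?_⟩, fun u w hw ↦ ?_,
    fun u v huv ↦ ?_⟩⟩
  · rw [Φ.adj_lineGraph_iff huv]
    constructor
    · rintro ⟨x, hu, hv⟩
      obtain ⟨y, hy, -, hy'⟩ := h4 u x hu
      obtain ⟨z, hz, -, hz'⟩ := h4 v x hv
      rw [hy', hz']
      exact hadj x y z hy hz
    · intro hle
      by_contra hn
      obtain ⟨x, hx⟩ : ∃ x, x ∈ (Φ u : Sym2 V) := ⟨_, Sym2.out_fst_mem _⟩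
      obtain ⟨x', hx'⟩ : ∃ x, x ∈ (Φ v : Sym2 V) := ⟨_, Sym2.out_fst_mem _⟩
      obtain ⟨y, hy, hu, hS⟩ := h4 u x hx
      obtain ⟨y', hy', hv, hS'⟩ := h4 v x' hx'
      rw [hu, hv, Sym2.exists_mem_and_mem_iff] at hn
      push Not at hn
      have := hT.inter_le x y x' y' hy hy' hn.1.1 hn.1.2 hn.2.1 hn.2.2
      rw [← hS, ← hS'] at this
      -- The contradiction `t ≤ t - 1` needs `1 ≤ t`, because of truncated subtraction.
      omega
  · obtain ⟨x, -, rfl⟩ := h3 u w (Or.inl hw)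
    exact hT.isLeaf x
  · rw [Φ.adj_lineGraph_iff huv]
    constructor
    · rintro ⟨x, hu, hv⟩
      exact ⟨φ x, hT.isLeaf x, hmem u x hu, hmem v x hv⟩
    · rintro ⟨w, hw, hu, hv⟩
      obtain ⟨x, hx, rfl⟩ := h3 u w (Or.inr ⟨hu, hw⟩)
      obtain ⟨y, hy, hxy⟩ := h3 v _ (Or.inr ⟨hv, hw⟩)
      exact ⟨x, hx, hT.injective hxy ▸ hy⟩

/-- The tree paths of an orthodox representation can be extended so that no two of their leaves
coincide: two new leaves are attached to each leaf of the tree. The paths are then given by pairs of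
distinct new leaves. -/
theorem IsOrthodoxRepresentation.exists_sym2 {U W : Type*} [Finite W] {h t : ℕ}
    {G : SimpleGraph U} {T : SimpleGraph W} {S : U → T.Subgraph}
    (hS : IsOrthodoxRepresentation h 2 t G T S) (u : U) :
    ∃ e : Sym2 ({w // IsLeaf T w} × Bool), ¬ e.IsDiag ∧
      (∀ w, (w, false) ∈ e ↔ w.1 ∈ (S u).verts) ∧ (∀ w, (w, true) ∈ e → w.1 ∈ (S u).verts) ∧
      ∀ p q, e = s(p, q) → T.pathVerts p.1 q.1 ⊆ (S u).verts := by
  obtain ⟨a, b, hab⟩ := Subgraph.exists_isSubtreeLeaf_iff (hS.subtree u) (hS.subtree_degree_le u)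
  have ha : IsLeaf T a := hS.leaf_of_leaf u a ((hab a).2 (Or.inl rfl))
  have hb : IsLeaf T b := hS.leaf_of_leaf u b ((hab b).2 (Or.inr rfl))
  have hiff : ∀ w : {w // IsLeaf T w}, w.1 ∈ (S u).verts ↔ w.1 = a ∨ w.1 = b := by
    intro w
    rw [← hab]
    refine ⟨fun hw ↦ ⟨hw, ?_⟩, fun hw ↦ hw.1⟩
    exact (Set.ncard_le_ncard ((S u).neighborSet_subset w.1) (Set.toFinite _)).trans w.2
  have hpath : ∀ (e : Sym2 ({w // IsLeaf T w} × Bool)), (∀ r ∈ e, r.1.1 ∈ (S u).verts) →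
      ∀ p q, e = s(p, q) → T.pathVerts p.1 q.1 ⊆ (S u).verts := by
    rintro e he p q rfl
    exact Subgraph.pathVerts_subset (hS.subtree u).connected (he p (by simp)) (he q (by simp))
  by_cases h : a = b
  · subst h
    -- A one-vertex subtree uses both new leaves at `a`. Every leaf of `T` in `S u` still
    -- contributes its `false` copy, so the `false` copies alone detect shared leaves.
    refine ⟨s((⟨a, ha⟩, false), (⟨a, ha⟩, true)), by simp, ?_, ?_, hpath _ ?_⟩
    · intro w; rw [hiff]; simp [Subtype.ext_iff]
    · intro w; rw [hiff]; simp [Subtype.ext_iff]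
    · intro r hr
      rw [hiff]
      rcases Sym2.mem_iff.1 hr with rfl | rfl <;> simp
  · refine ⟨s((⟨a, ha⟩, false), (⟨b, hb⟩, false)), by simpa using h, ?_, ?_, hpath _ ?_⟩
    · intro w; rw [hiff]; simp [Subtype.ext_iff]
    · intro w; rw [hiff]; simp [Subtype.ext_iff]
    · intro r hr
      rw [hiff]
      rcases Sym2.mem_iff.1 hr with rfl | rfl <;> simp

/-- An orthodox representation of a twin-free line graph yields a tree layout of its root. -/
theorem IsOrthodoxRepresentation.exists_isLooseTreeLayout {U V W : Type*} [Finite U] [Finite W]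
    {h t : ℕ} {G : SimpleGraph U} {H : SimpleGraph V} {T : SimpleGraph W} {S : U → T.Subgraph}
    (hS : IsOrthodoxRepresentation h 2 t G T S) (hGtwin : TwinFree G) (hGcard : 4 ≤ Nat.card U)
    (hH : H.Connected) (Φ : G ≃g H.lineGraph) (hh : 3 ≤ h) :
    ∃ φ : V → W ⊕ ({w // IsLeaf T w} × Bool),
      IsLooseTreeLayout h t H (T.attachLeaves fun a : {w // IsLeaf T w} × Bool ↦ a.1.1) φ := by
  classical
  choose e hdiag hfalse htrue hpath using hS.exists_sym2
  have hmeet : ∀ u v, u ≠ v → ((∃ p, p ∈ e u ∧ p ∈ e v) ↔ G.Adj u v) := by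
    intro u v huv
    rw [hS.adj_iff_leaf u v huv]
    constructor
    · rintro ⟨⟨w, _ | _⟩, hu, hv⟩
      · exact ⟨w, w.2, (hfalse u w).1 hu, (hfalse v w).1 hv⟩
      · exact ⟨w, w.2, htrue u w hu, htrue v w hv⟩
    · rintro ⟨w, hw, hu, hv⟩
      exact ⟨(⟨w, hw⟩, false), (hfalse u ⟨w, hw⟩).2 hu, (hfalse v ⟨w, hw⟩).2 hv⟩
  have hmeet' : ∀ u v, (∃ p, p ∈ e u ∧ p ∈ e v) ↔
      ∃ x, x ∈ (Φ u : Sym2 V) ∧ x ∈ (Φ v : Sym2 V) := by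
    intro u v
    by_cases huv : u = v
    · subst huv
      exact ⟨fun _ ↦ ⟨_, Sym2.out_fst_mem _, Sym2.out_fst_mem _⟩,
        fun _ ↦ ⟨_, Sym2.out_fst_mem _, Sym2.out_fst_mem _⟩⟩
    · rw [hmeet u v huv, Φ.adj_lineGraph_iff huv]
  have hUne : Nonempty U := (Nat.card_pos_iff.1 (by omega)).1
  obtain ⟨u₀⟩ := hUne
  -- The value `e u₀` off the edge set is arbitrary.
  let m : Sym2 V → Sym2 ({w // IsLeaf T w} × Bool) := fun f ↦
    if hf : f ∈ H.edgeSet then e (Φ.symm ⟨f, hf⟩) else e u₀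
  have hmΦ : ∀ u, m (Φ u) = e u := fun u ↦ by
    simp only [m, dif_pos (Φ u).2, Subtype.coe_eta, RelIso.symm_apply_apply]
  have hsurj : ∀ f ∈ H.edgeSet, ∃ u, (Φ u : Sym2 V) = f := fun f hf ↦
    ⟨Φ.symm ⟨f, hf⟩, by simp⟩
  have hm : IsLineGraphMap H m := by
    refine ⟨?_, ?_, ?_⟩
    · intro f hf
      obtain ⟨u, rfl⟩ := hsurj f hf
      rw [hmΦ]
      exact hdiag u
    · intro f hf g hg
      obtain ⟨u, rfl⟩ := hsurj f hf
      obtain ⟨v, rfl⟩ := hsurj g hg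
      rw [hmΦ, hmΦ, hmeet']
    · intro f hf g hg hfg
      obtain ⟨u, rfl⟩ := hsurj f hf
      obtain ⟨v, rfl⟩ := hsurj g hg
      by_contra hne
      have huv : u ≠ v := fun h ↦ hne (h ▸ rfl)
      refine hGtwin u v huv (Set.ext fun w ↦ ?_)
      have key : ∀ u, w ∈ insert u (G.neighborSet u) ↔
          ∃ x, x ∈ (Φ u : Sym2 V) ∧ x ∈ (Φ w : Sym2 V) := by
        intro u
        by_cases huw : u = w
        · subst huw
          exact ⟨fun _ ↦ ⟨_, Sym2.out_fst_mem _, Sym2.out_fst_mem _⟩, fun _ ↦ Or.inl rfl⟩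
        · rw [← Φ.adj_lineGraph_iff huw, Set.mem_insert_iff, mem_neighborSet,
            or_iff_right (Ne.symm huw)]
      rw [key, key]
      exact hfg _ (Φ w).2
  have hE : ∀ e₁ e₂ e₃ : Sym2 V, ∃ e ∈ H.edgeSet, e ≠ e₁ ∧ e ≠ e₂ ∧ e ≠ e₃ := by
    intro e₁ e₂ e₃
    by_contra! hn
    have hsub : H.edgeSet ⊆ (({e₁, e₂, e₃} : Finset (Sym2 V)) : Set (Sym2 V)) := by
      intro f hf
      have := hn f hf
      simp only [Finset.coe_insert, Finset.coe_singleton, Set.mem_insert_iff,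
        Set.mem_singleton_iff]
      tauto
    have h1 := Set.ncard_le_ncard hsub (Finset.finite_toSet _)
    rw [Set.ncard_coe_finset, ← Nat.card_coe_set_eq, ← Nat.card_congr Φ.toEquiv] at h1
    have := Finset.card_le_three (a := e₁) (b := e₂) (c := e₃)
    omega
  obtain ⟨ψ, hψ, hψe⟩ := hm.exists_injective hH hE
  -- Here `u` need not correspond to the edge `xy`, since the injection may permute the edges.
  have hedge : ∀ x y, H.Adj x y → ∃ u, e u = s(ψ x, ψ y) := by
    intro x y hxy
    obtain ⟨f, hf, hfe⟩ := hψe x y hxy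
    obtain ⟨u, rfl⟩ := hsurj f hf
    exact ⟨u, (hmΦ u).symm.trans hfe⟩
  refine ⟨fun v ↦ Sum.inr (ψ v), hS.isTree.attachLeaves _, ?_,
    Sum.inr_injective.comp hψ, fun v ↦ isLeaf_attachLeaves_inr _ _, ?_⟩
  · refine ncard_neighborSet_attachLeaves_le _ hh hS.degree_le (fun a ↦ a.1.2) fun x ↦ ?_
    by_cases hx : IsLeaf T x
    · have hsub : (fun a : {w // IsLeaf T w} × Bool ↦ a.1.1) ⁻¹' {x} ⊆
          {(⟨x, hx⟩, false), (⟨x, hx⟩, true)} := by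
        rintro ⟨⟨w, hw⟩, _ | _⟩ rfl <;> simp
      exact (Set.ncard_le_ncard hsub (Set.toFinite _)).trans ((Set.ncard_insert_le _ _).trans (by rw [Set.ncard_singleton]))
    · have : (fun a : {w // IsLeaf T w} × Bool ↦ a.1.1) ⁻¹' {x} = ∅ := by
        ext a
        simp only [Set.mem_preimage, Set.mem_singleton_iff, Set.mem_empty_iff_false, iff_false]
        rintro rfl
        exact hx a.1.2
      simp [this]
  · intro x y x' y' hxy hxy' h1 h2 h3 h4
    obtain ⟨u, hu⟩ := hedge x y hxy
    obtain ⟨v, hv⟩ := hedge x' y' hxy'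
    have hdisj : ¬ ∃ p, p ∈ e u ∧ p ∈ e v := by
      rw [hu, hv, Sym2.exists_mem_and_mem_iff]
      simp [hψ.eq_iff, h1, h2, h3, h4]
    have huv : u ≠ v := by
      rintro rfl
      exact hdisj ⟨_, Sym2.out_fst_mem _, Sym2.out_fst_mem _⟩
    have hlt : ((S u).verts ∩ (S v).verts).ncard < t := by
      rw [← not_le, ← hS.adj_iff u v huv, ← hmeet u v huv]
      exact hdisj
    refine le_trans ?_ (Nat.le_sub_one_of_lt hlt)
    refine (hS.isTree.ncard_inter_pathVerts_attachLeaves_le _ (hψ.ne hxy.ne) (hψ.ne hxy'.ne)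
      (hψ.ne h1) (hψ.ne h2) (hψ.ne h3) (hψ.ne h4)).trans (Set.ncard_le_ncard ?_ (Set.toFinite _))
    exact Set.inter_subset_inter (hpath u _ _ hu) (hpath v _ _ hv)

theorem theorem2 {U V : Type*} [Finite U] [Finite V] (G : SimpleGraph U) (H : SimpleGraph V)
    (hG : G.Connected) (hGtwin : TwinFree G) (hGcard : 4 ≤ Nat.card U)
    (hH : H.Connected) (hGH : Nonempty (G ≃g H.lineGraph))
    (h t : ℕ) (hh : 3 ≤ h) (ht : 1 ≤ t) :
    InORTH h 2 t G ↔
      ∃ (W : Type) (_ : Finite W) (T : SimpleGraph W) (φ : V → W), IsTreeLayout h t H T φ := by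
  obtain ⟨Φ⟩ := hGH
  constructor
  · rintro ⟨W, _, T, S, hS⟩
    obtain ⟨φ, hφ⟩ := hS.exists_isLooseTreeLayout hGtwin hGcard hH Φ hh
    obtain ⟨u⟩ := hG.nonempty
    have : Nontrivial V := by
      obtain ⟨e, he⟩ := Φ u
      induction e with
      | h x y => exact ⟨x, y, H.ne_of_adj he⟩
    exact hφ.exists_isTreeLayout
  · rintro ⟨W, _, T, φ, hT⟩
    -- Lengthening `t` times gives any two edges of `H` with a common end at least `t` common path
    -- vertices.
    obtain ⟨W, _, T, φ, hT, hk⟩ :=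
      (hT.isLooseTreeLayout (by omega)).exists_le_ncard_inter hh t
    obtain ⟨S, hS⟩ := hT.inORTH Φ ht hk
    exact ⟨W, inferInstance, T, S, hS⟩
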